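/- Let $c\neq 0$ be real and put $f(x,y)=\frac{x-y+ic}{x-y}$, $g(x,y)=\frac{ic}{x-y}$, $S(x)=\frac{x-ic}{x+ic}$. Consider the Algebraic Bethe Ansatz for the one-dimensional Bose gas: operators $\mathbb A,\mathbb B,\mathbb C,\mathbb D$ (the entries of the monodromy matrix, divided by the vacuum eigenvalue $d$ of its lower right entry), fields $\Psi,\Psi^\dagger$ and a vacuum with $\langle 0|0\rangle=1$, subject to the relations that follow from the XXX-type Yang–Baxter (RTT) algebra, $$\mathbb A(x)\mathbb B(y)=f(x,y)\mathbb B(y)\mathbb A(x)+g(y,x)\mathbb B(x)\mathbb A(y),\qquad \mathbb D(x)\mathbb B(y)=f(y,x)\mathbb B(y)\mathbb D(x)+g(x,y)\mathbb B(x)\mathbb D(y),$$ $$\mathbb C(x)\mathbb D(y)=f(x,y)\mathbb D(y)\mathbb C(x)+g(y,x)\mathbb D(x)\mathbb C(y),\qquad [\mathbb C(x),\mathbb B(y)]=g(x,y)\bigl(\mathbb A(x)\mathbb D(y)-\mathbb A(y)\mathbb D(x)\bigr),$$ to $[\Psi,\mathbb B(x)]=-i\sqrt c\,\mathbb A(x)$,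 $[\mathbb C(x),\Psi^\dagger]=i\sqrt c\,\mathbb D(x)$, and to $\mathbb A(x)|0\rangle=l(x)|0\rangle$, $\mathbb D(x)|0\rangle=|0\rangle$, $\mathbb C(x)|0\rangle=\Psi|0\rangle=0$, $\langle0|\mathbb D(x)=\langle0|$, $\langle0|\mathbb B(x)=\langle0|\Psi^\dagger=0$. Let $k,N\ge 0$. Using these relations only, one obtains the off-shell matrix element $$M^k_{2N}(\{x^C\},\{x^B\},\{l^C\},\{l^B\})=\langle0|\prod_{j=1}^N\mathbb C(x^C_j)\,(\Psi^\dagger)^k\Psi^k\prod_{j=1}^N\mathbb B(x^B_j)|0\rangle$$ as a function of $4N$ independent variables, where $l^{C,B}_j=l(x^{C,B}_j)$. For rapidities $x=(x_1,\dots,x_N)$ let $l_j(x)=\prod_{m\ne j}S(x_m-x_j)^{-1}$, i.e. the Bethe equations $l_j\prod_{m\neq j}S(x_m-x_j)=1$ hold, and define the form factor $\mathbb F^k_{2N}(x^C|x^B)=M^k_{2N}(x^C,x^B,l(x^C),l(x^B))$ and its symmetric diagonal limit (the irreducible part) $$\mathbb F^k_{2N,s}(x)=\lim_{\varepsilon\to0}\mathbb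 F^k_{2N}(x_1+\varepsilon,\dots,x_N+\varepsilon\,|\,x_1,\dots,x_N).$$ The on-shell mean value $\langle\mathcal O_k\rangle_N(x,z)$ of $\mathcal O_k=(\Psi^\dagger)^k\Psi^k$, a function of $x$ and of $z=(z_1,\dots,z_N)$, is the diagonal limit of $M^k_{2N}(y,x,(\ell(y_j))_j,l(x))$ as $y_j\to x_j$, $y_j\ne x_j$, for any function $\ell$ that is differentiable at the points $x_j$ with $\ell(x_j)=l_j(x)$ and $i\,\frac{d}{dx}\log \ell\,(x_j)=z_j$; the limit does not depend on the choice of $\ell$. **Theorem.** Let $x_1,\dots,x_N\in\mathbb C$ be pairwise distinct with $x_j-x_m\neq ic$ for $j\neq m$ (for example, distinct real rapidities). Then the symmetric limit $\mathbb F^k_{2N,s}(x)$ exists, the on-shell mean value at $z_1=\dots=z_N=0$ exists (functions $\ell$ as above exist, and the limit exists and is the same for all of them), and $$\mathbb F^k_{2N,s}(x_1,\dots,x_N)=\langle\mathcal O_k\rangle_N(\{x_1,\dots,x_N\},\{0,\dots,0\}).$$ -/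

import Mathlib

open scoped Kronecker

noncomputable section

namespace BoseABA

/-! ## Algebraic Bethe Ansatz for the one-dimensional Bose gas, off shell

The functions `f`, `g`, the two-particle S-matrix and the R-matrix of XXX type, with coupling
constant `c`.  -/

def f (c : ℝ) (x y : ℂ) : ℂ := (x - y + Complex.I * c) / (x - y)

def g (c : ℝ) (x y : ℂ) : ℂ := Complex.I * c / (x - y)

/-- The two-particle S-matrix of the Lieb-Liniger model. -/
def sMatrix (c : ℝ) (x : ℂ) : ℂ := (x - Complex.I * c) / (x + Complex.I * c)

/-- A complex square root of the coupling constant (the usual one if `0 < c`). -/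
def sqrtC (c : ℝ) : ℂ := (c : ℂ) ^ (1 / 2 : ℂ)

/-- A pair `(x, l)`: a spectral parameter `x` together with the value `l = l(x) = a(x) / d(x)` of
the ratio of vacuum eigenvalues.  Off shell the two entries are independent variables. -/
abbrev Param := ℂ × ℂ

/-- Formal linear combinations of the off-shell vectors `𝔹(q₁) ⋯ 𝔹(qₙ) |0⟩`, encoded by the word
`[q₁, …, qₙ]`.  Here `𝔹 = B / d`, and likewise `𝔸 = A / d`, `ℂ = C / d`, `𝔻 = D / d`. -/
abbrev Ket := List Param →₀ ℂ

/-- Formal linear combinations of the off-shell covectors `⟨0| ℂ(qₙ) ⋯ ℂ(q₁)`, encoded by the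
word `[q₁, …, qₙ]`: the head of the word is the operator that stands furthest to the right. -/
abbrev Bra := List Param →₀ ℂ

/-- Put one more operator (`𝔹(q)` for a ket, `ℂ(q)` for a bra) at the outer end. -/
def cons (q : Param) : (List Param →₀ ℂ) →ₗ[ℂ] (List Param →₀ ℂ) :=
  Finsupp.lmapDomain ℂ ℂ (List.cons q)

/-- `𝔸(p)` on `𝔹(q₁) ⋯ 𝔹(qₙ) |0⟩`, by `𝔸(p) |0⟩ = l(p) |0⟩` and
`𝔸(p) 𝔹(q) = f(p,q) 𝔹(q) 𝔸(p) + g(q,p) 𝔹(p) 𝔸(q)`. -/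
def ketAWord (c : ℝ) : Param → List Param → Ket
  | p, [] => Finsupp.single [] p.2
  | p, q :: s => f c p.1 q.1 • cons q (ketAWord c p s) + g c q.1 p.1 • cons p (ketAWord c q s)

/-- `𝔻(p)` on `𝔹(q₁) ⋯ 𝔹(qₙ) |0⟩`, by `𝔻(p) |0⟩ = |0⟩` and
`𝔻(p) 𝔹(q) = f(q,p) 𝔹(q) 𝔻(p) + g(p,q) 𝔹(p) 𝔻(q)`. -/
def ketDWord (c : ℝ) : Param → List Param → Ket
  | _, [] => Finsupp.single [] 1
  | p, q :: s => f c q.1 p.1 • cons q (ketDWord c p s) + g c p.1 q.1 • cons p (ketDWord c q s)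

def ketA (c : ℝ) (p : Param) : Ket →ₗ[ℂ] Ket := Finsupp.linearCombination ℂ (ketAWord c p)

/-- `ℂ(p)` on `𝔹(q₁) ⋯ 𝔹(qₙ) |0⟩`, by `ℂ(p) |0⟩ = 0` and
`ℂ(p) 𝔹(q) = 𝔹(q) ℂ(p) + g(p,q) (𝔸(p) 𝔻(q) - 𝔸(q) 𝔻(p))`. -/
def ketCWord (c : ℝ) (p : Param) : List Param → Ket
  | [] => 0
  | q :: s => cons q (ketCWord c p s)
      + g c p.1 q.1 • (ketA c p (ketDWord c q s) - ketA c q (ketDWord c p s))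

def ketC (c : ℝ) (p : Param) : Ket →ₗ[ℂ] Ket := Finsupp.linearCombination ℂ (ketCWord c p)

/-- The field `Ψ` on `𝔹(q₁) ⋯ 𝔹(qₙ) |0⟩`, by `Ψ |0⟩ = 0` and `Ψ 𝔹(q) = 𝔹(q) Ψ - i √c 𝔸(q)`. -/
def ketPsiWord (c : ℝ) : List Param → Ket
  | [] => 0
  | q :: s => cons q (ketPsiWord c s) - (Complex.I * sqrtC c) • ketAWord c q s

def ketPsi (c : ℝ) : Ket →ₗ[ℂ] Ket := Finsupp.linearCombination ℂ (ketPsiWord c)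

/-- `𝔻(p)` acting to the left on `⟨0| ℂ(qₙ) ⋯ ℂ(q₁)`, by `⟨0| 𝔻(p) = ⟨0|` and
`ℂ(q) 𝔻(p) = f(q,p) 𝔻(p) ℂ(q) + g(p,q) 𝔻(q) ℂ(p)`. -/
def braDWord (c : ℝ) : Param → List Param → Bra
  | _, [] => Finsupp.single [] 1
  | p, q :: s => f c q.1 p.1 • cons q (braDWord c p s) + g c p.1 q.1 • cons p (braDWord c q s)

/-- The field `Ψ†` acting to the left on `⟨0| ℂ(qₙ) ⋯ ℂ(q₁)`, by `⟨0| Ψ† = 0` and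
`ℂ(q) Ψ† = Ψ† ℂ(q) + i √c 𝔻(q)`. -/
def braPsiDagWord (c : ℝ) : List Param → Bra
  | [] => 0
  | q :: s => cons q (braPsiDagWord c s) + (Complex.I * sqrtC c) • braDWord c q s

def braPsiDag (c : ℝ) : Bra →ₗ[ℂ] Bra := Finsupp.linearCombination ℂ (braPsiDagWord c)

/-- `⟨0| ℂ(qₙ) ⋯ ℂ(q₁)` evaluated on a ket, by `⟨0|0⟩ = 1` and `⟨0| 𝔹(q) = 0`. -/
def braWordEval (c : ℝ) : List Param → (Ket →ₗ[ℂ] ℂ)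
  | [] => Finsupp.lapply []
  | q :: s => braWordEval c s ∘ₗ ketC c q

/-- The pairing of a bra and a ket. -/
def pairing (c : ℝ) : Bra →ₗ[ℂ] (Ket →ₗ[ℂ] ℂ) := Finsupp.linearCombination ℂ (braWordEval c)

/-- The word of the parameters `(x₁, l₁), …, (x_N, l_N)`. -/
def word {N : ℕ} (x l : Fin N → ℂ) : List Param := List.ofFn fun j => (x j, l j)

/-- The un-normalized off-shell matrix element
`M^k_{2N}({x^C}, {x^B}, {l^C}, {l^B}) = ⟨0| ∏ ℂ(x^C_j) (Ψ†)^k Ψ^k ∏ 𝔹(x^B_j) |0⟩`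
as a function of `4N` independent variables. -/
def offShell (c : ℝ) (k : ℕ) {N : ℕ} (xC xB lC lB : Fin N → ℂ) : ℂ :=
  pairing c (((braPsiDag c) ^ k) (Finsupp.single (word xC lC) 1))
    (((ketPsi c) ^ k) (Finsupp.single (word xB lB) 1))

/-! ## The off-shell matrix element in representations

`offShell` is obtained from the commutation relations alone.  The theorem `offShell_eq` confirms
this: it is the matrix element in every representation of the RTT relation with field operators. -/

/-- The R-matrix, in the convention in which
`A(x) B(y) = f(x,y) B(y) A(x) + g(y,x) B(x) A(y)` follows from the RTT relation. -/
def rMatrix (c : ℝ) (x y : ℂ) : Matrix (Fin 2 × Fin 2) (Fin 2 × Fin 2) ℂ :=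
  (Matrix.of ![![f c y x, 0, 0, 0], ![0, g c y x, 1, 0], ![0, 1, g c y x, 0],
    ![0, 0, 0, f c y x]]).submatrix (finProdFinEquiv (m := 2) (n := 2)) finProdFinEquiv

/-- A representation of the RTT relation, with monodromy matrix `T = (A, B; C, D)`, field
operators at the origin, vacuum and dual vacuum. -/
structure Representation (c : ℝ) (a d : ℂ → ℂ) (H : Type*) [AddCommGroup H] [Module ℂ H] where
  T : ℂ → Matrix (Fin 2) (Fin 2) (Module.End ℂ H)
  Psi : Module.End ℂ H
  PsiDag : Module.End ℂ H
  vac : H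
  covac : H →ₗ[ℂ] ℂ
  rtt : ∀ x y, x ≠ y →
    (rMatrix c x y).map (algebraMap ℂ (Module.End ℂ H)) * (T x ⊗ₖ T y)
      = (T y ⊗ₖ T x) * (rMatrix c x y).map (algebraMap ℂ (Module.End ℂ H))
  psi_B : ∀ x, Psi * T x 0 1 - T x 0 1 * Psi = -(Complex.I * sqrtC c) • T x 0 0
  C_psiDag : ∀ x, T x 1 0 * PsiDag - PsiDag * T x 1 0 = (Complex.I * sqrtC c) • T x 1 1
  A_vac : ∀ x, T x 0 0 vac = a x • vac
  D_vac : ∀ x, T x 1 1 vac = d x • vac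
  C_vac : ∀ x, T x 1 0 vac = 0
  psi_vac : Psi vac = 0
  covac_A : ∀ x, covac ∘ₗ T x 0 0 = a x • covac
  covac_D : ∀ x, covac ∘ₗ T x 1 1 = d x • covac
  covac_B : ∀ x, covac ∘ₗ T x 0 1 = 0
  covac_psiDag : covac ∘ₗ PsiDag = 0
  covac_vac : covac vac = 1

namespace Representation

variable {c : ℝ} {a d : ℂ → ℂ} {H : Type*} [AddCommGroup H] [Module ℂ H]

/-- The normalized entries `𝔸, 𝔹, ℂ, 𝔻` of the monodromy matrix. -/
def op (ρ : Representation c a d H) (i j : Fin 2) (p : Param) : Module.End ℂ H :=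
  (d p.1)⁻¹ • ρ.T p.1 i j

/-- The vector `𝔹(q₁) ⋯ 𝔹(qₙ) |0⟩`. -/
def ketVec (ρ : Representation c a d H) : List Param → H
  | [] => ρ.vac
  | q :: s => ρ.op 0 1 q (ketVec ρ s)

/-- The covector `⟨0| ℂ(qₙ) ⋯ ℂ(q₁)`. -/
def braVec (ρ : Representation c a d H) : List Param → (H →ₗ[ℂ] ℂ)
  | [] => ρ.covac
  | q :: s => braVec ρ s ∘ₗ ρ.op 1 0 q

end Representation

namespace Aux

variable {c : ℝ} {a d : ℂ → ℂ} {H : Type*} [AddCommGroup H] [Module ℂ H]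

theorem g_swap (c : ℝ) (x y : ℂ) : g c y x = -g c x y := by
  unfold g; rw [← neg_sub x y, div_neg]

theorem AB (ρ : Representation c a d H) (p q : Param) (h : p.1 ≠ q.1) (v : H) :
    ρ.op 0 0 p (ρ.op 0 1 q v)
      = f c p.1 q.1 • ρ.op 0 1 q (ρ.op 0 0 p v) + g c q.1 p.1 • ρ.op 0 1 p (ρ.op 0 0 q v) := by
  have h1 := LinearMap.congr_fun (congrFun₂ (ρ.rtt q.1 p.1 h.symm) (0, 0) (1, 0)) v
  simp [rMatrix, Matrix.mul_apply, Fintype.sum_prod_type, Matrix.submatrix, finProdFinEquiv,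
    Fin.sum_univ_two] at h1
  simp only [Representation.op, LinearMap.smul_apply, map_smul, g_swap c p.1 q.1,
    eq_sub_of_add_eq h1.symm]
  module

theorem DB (ρ : Representation c a d H) (p q : Param) (h : p.1 ≠ q.1) (v : H) :
    ρ.op 1 1 p (ρ.op 0 1 q v)
      = f c q.1 p.1 • ρ.op 0 1 q (ρ.op 1 1 p v) + g c p.1 q.1 • ρ.op 0 1 p (ρ.op 1 1 q v) := by
  have h1 := LinearMap.congr_fun (congrFun₂ (ρ.rtt p.1 q.1 h) (0, 1) (1, 1)) v
  simp [rMatrix, Matrix.mul_apply, Fintype.sum_prod_type, Matrix.submatrix, finProdFinEquiv,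
    Fin.sum_univ_two] at h1
  simp only [Representation.op, LinearMap.smul_apply, map_smul, g_swap c q.1 p.1,
    eq_sub_of_add_eq' h1]
  module

theorem CB (ρ : Representation c a d H) (p q : Param) (h : p.1 ≠ q.1) (v : H) :
    ρ.op 1 0 p (ρ.op 0 1 q v)
      = ρ.op 0 1 q (ρ.op 1 0 p v)
        + g c p.1 q.1 • (ρ.op 0 0 p (ρ.op 1 1 q v) - ρ.op 0 0 q (ρ.op 1 1 p v)) := by
  have h1 := LinearMap.congr_fun (congrFun₂ (ρ.rtt p.1 q.1 h) (0, 1) (0, 1)) v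
  simp [rMatrix, Matrix.mul_apply, Fintype.sum_prod_type, Matrix.submatrix, finProdFinEquiv,
    Fin.sum_univ_two] at h1
  simp only [Representation.op, LinearMap.smul_apply, map_smul, g_swap c q.1 p.1,
    eq_sub_of_add_eq' h1]
  module

theorem CD (ρ : Representation c a d H) (p q : Param) (h : p.1 ≠ q.1) (v : H) :
    ρ.op 1 0 q (ρ.op 1 1 p v)
      = f c q.1 p.1 • ρ.op 1 1 p (ρ.op 1 0 q v) + g c p.1 q.1 • ρ.op 1 1 q (ρ.op 1 0 p v) := by
  have h1 := LinearMap.congr_fun (congrFun₂ (ρ.rtt p.1 q.1 h) (1, 1) (1, 0)) v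
  simp [rMatrix, Matrix.mul_apply, Fintype.sum_prod_type, Matrix.submatrix, finProdFinEquiv,
    Fin.sum_univ_two] at h1
  simp only [Representation.op, LinearMap.smul_apply, map_smul, g_swap c q.1 p.1,
    eq_sub_of_add_eq h1.symm]
  module

def Good (a d : ℂ → ℂ) (w : List Param) : Prop :=
  (w.map Prod.fst).Nodup ∧ ∀ r ∈ w, d r.1 ≠ 0 ∧ r.2 = a r.1 / d r.1

theorem cons_sub {w w' : List Param} (p : Param) (h : w'.Subperm w) :
    (p :: w').Subperm (p :: w) := (List.subperm_cons p).2 h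

theorem nodup_of {w w' : List Param} (h : w'.Subperm w) (hw : (w.map Prod.fst).Nodup) :
    (w'.map Prod.fst).Nodup := by
  obtain ⟨u, hu, hs⟩ := h
  exact ((hu.map Prod.fst).nodup_iff).1 (hw.sublist (hs.map Prod.fst))

theorem Good.mono {w w' : List Param} (h : Good a d w) (hw : w'.Subperm w) : Good a d w' :=
  ⟨nodup_of hw h.1, fun r hr => h.2 r (hw.subset hr)⟩

def sup (w : List Param) : Submodule ℂ (List Param →₀ ℂ) :=
  Finsupp.supported ℂ ℂ {w' | w'.Subperm w}

theorem cons_mem {w w₁ : List Param} {q : Param} {v : List Param →₀ ℂ} (hv : v ∈ sup w)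
    (h : (q :: w).Subperm w₁) : cons q v ∈ sup w₁ := by
  classical
  rw [sup, Finsupp.mem_supported] at *
  intro x hx
  have hx' := Finsupp.mapDomain_support hx
  obtain ⟨y, hy, rfl⟩ := Finset.mem_image.1 hx'
  exact (cons_sub q (hv hy)).trans h

theorem cons_single (q : Param) (w : List Param) (z : ℂ) :
    cons q (Finsupp.single w z) = Finsupp.single (q :: w) z := by
  simp [cons]

theorem sup_mono {w w₁ : List Param} (h : w.Subperm w₁) {v : List Param →₀ ℂ}
    (hv : v ∈ sup w) : v ∈ sup w₁ :=
  Finsupp.supported_mono (fun _ hx => List.Subperm.trans hx h) hv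

theorem eq_on {M : Type*} [AddCommGroup M] [Module ℂ M] {L L' : (List Param →₀ ℂ) →ₗ[ℂ] M}
    {w : List Param} {v : List Param →₀ ℂ} (hv : v ∈ sup w)
    (h : ∀ w', w'.Subperm w → L (Finsupp.single w' 1) = L' (Finsupp.single w' 1)) :
    L v = L' v := by
  have := Finsupp.supported_eq_span_single ℂ {w' : List Param | w'.Subperm w}
  rw [sup, this] at hv
  exact LinearMap.eqOn_span' (by rintro _ ⟨w', hw', rfl⟩; exact h w' hw') hv

theorem map_mem {L : (List Param →₀ ℂ) →ₗ[ℂ] (List Param →₀ ℂ)}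
    {w w₁ : List Param} {v : List Param →₀ ℂ} (hv : v ∈ sup w)
    (h : ∀ w', w'.Subperm w → L (Finsupp.single w' 1) ∈ sup w₁) : L v ∈ sup w₁ := by
  have := Finsupp.supported_eq_span_single ℂ {w' : List Param | w'.Subperm w}
  rw [sup, this] at hv
  have h2 : Submodule.span ℂ ((fun i => Finsupp.single i (1 : ℂ)) '' {w' : List Param | w'.Subperm w})
      ≤ (sup w₁).comap L := Submodule.span_le.2 (by rintro _ ⟨w', hw', rfl⟩; exact h w' hw')
  exact h2 hv

theorem ketA_mem (c : ℝ) (s : List Param) : ∀ p, ketAWord c p s ∈ sup (p :: s) := by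
  induction s with
  | nil =>
    intro p
    exact Finsupp.single_mem_supported ℂ _ (List.nil_subperm)
  | cons q s ih =>
    intro p
    exact add_mem (Submodule.smul_mem _ _ (cons_mem (ih p) (List.Perm.swap _ _ _).subperm))
      (Submodule.smul_mem _ _ (cons_mem (ih q) (List.Subperm.refl _)))

theorem ketD_mem (c : ℝ) (s : List Param) : ∀ p, ketDWord c p s ∈ sup (p :: s) := by
  induction s with
  | nil =>
    intro p
    exact Finsupp.single_mem_supported ℂ _ (List.nil_subperm)
  | cons q s ih =>
    intro p
    exact add_mem (Submodule.smul_mem _ _ (cons_mem (ih p) (List.Perm.swap _ _ _).subperm))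
      (Submodule.smul_mem _ _ (cons_mem (ih q) (List.Subperm.refl _)))

theorem braD_eq (c : ℝ) (s : List Param) : ∀ p, braDWord c p s = ketDWord c p s := by
  induction s with
  | nil => intro p; rfl
  | cons q s ih => intro p; simp only [braDWord, ketDWord, ih]

theorem ketA_single (c : ℝ) (p : Param) (w : List Param) :
    ketA c p (Finsupp.single w 1) = ketAWord c p w := by simp [ketA]

theorem ketAD_mem (c : ℝ) (p q : Param) (s : List Param) :
    ketA c p (ketDWord c q s) ∈ sup (p :: q :: s) :=
  map_mem (ketD_mem c s q) fun w' hw' => by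
    rw [ketA_single]; exact sup_mono (cons_sub p hw') (ketA_mem c w' p)

theorem ketC_mem (c : ℝ) (p : Param) (s : List Param) : ketCWord c p s ∈ sup (p :: s) := by
  induction s with
  | nil => exact zero_mem _
  | cons q s ih =>
    refine add_mem (cons_mem ih (List.Perm.swap _ _ _).subperm) (Submodule.smul_mem _ _
      (sub_mem (ketAD_mem c p q s) (sup_mono (List.Perm.swap _ _ _).subperm (ketAD_mem c q p s))))

theorem ketPsi_mem (c : ℝ) (s : List Param) : ketPsiWord c s ∈ sup s := by
  induction s with
  | nil => exact zero_mem _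
  | cons q s ih =>
    exact sub_mem (cons_mem ih (List.Subperm.refl _)) (Submodule.smul_mem _ _ (ketA_mem c s q))

theorem braPsiDag_mem (c : ℝ) (s : List Param) : braPsiDagWord c s ∈ sup s := by
  induction s with
  | nil => exact zero_mem _
  | cons q s ih =>
    refine add_mem (cons_mem ih (List.Subperm.refl _)) (Submodule.smul_mem _ _ ?_)
    rw [braD_eq]; exact ketD_mem c s q

/-- The interpretation of kets and bras in a representation. -/
def ket (ρ : Representation c a d H) : Ket →ₗ[ℂ] H := Finsupp.linearCombination ℂ ρ.ketVec

def bra (ρ : Representation c a d H) : Bra →ₗ[ℂ] (H →ₗ[ℂ] ℂ) :=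
  Finsupp.linearCombination ℂ ρ.braVec

theorem ket_single (ρ : Representation c a d H) (w : List Param) :
    ket ρ (Finsupp.single w 1) = ρ.ketVec w := by simp [ket]

theorem bra_single (ρ : Representation c a d H) (w : List Param) :
    bra ρ (Finsupp.single w 1) = ρ.braVec w := by simp [bra]

theorem ket_cons (ρ : Representation c a d H) (q : Param) (v : Ket) :
    ket ρ (cons q v) = ρ.op 0 1 q (ket ρ v) := by
  have : ket ρ ∘ₗ cons q = ρ.op 0 1 q ∘ₗ ket ρ := by
    ext w; simp [ket, cons, Representation.ketVec]
  exact LinearMap.congr_fun this v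

theorem bra_cons (ρ : Representation c a d H) (q : Param) (v : Bra) :
    bra ρ (cons q v) = bra ρ v ∘ₗ ρ.op 1 0 q := by
  have : bra ρ ∘ₗ cons q = (ρ.op 1 0 q).lcomp ℂ ℂ ∘ₗ bra ρ := by
    ext w; simp [bra, cons, Representation.braVec]
  exact LinearMap.congr_fun this v

theorem fst_ne {p q : Param} {s : List Param} (h : Good a d (p :: q :: s)) : p.1 ≠ q.1 := by
  have := h.1
  simp at this
  tauto

theorem Good.tail {p : Param} {s : List Param} (h : Good a d (p :: s)) : Good a d s :=
  h.mono (List.sublist_cons_self p s).subperm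

theorem Good.drop {p q : Param} {s : List Param} (h : Good a d (p :: q :: s)) :
    Good a d (p :: s) :=
  h.mono (cons_sub p (List.sublist_cons_self q s).subperm)

theorem ket_A (ρ : Representation c a d H) (s : List Param) : ∀ p, Good a d (p :: s) →
    ket ρ (ketAWord c p s) = ρ.op 0 0 p (ρ.ketVec s) := by
  induction s with
  | nil =>
    intro p hp
    obtain ⟨-, h2⟩ := hp.2 p (by simp)
    rw [ketAWord, ket, Finsupp.linearCombination_single, h2]
    simp [Representation.op, Representation.ketVec, ρ.A_vac, smul_smul, div_eq_inv_mul]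
  | cons q s ih =>
    intro p hp
    rw [Representation.ketVec, AB ρ p q (fst_ne hp), ketAWord, map_add, map_smul, map_smul,
      ket_cons, ket_cons, ih p hp.drop, ih q hp.tail]

theorem ket_D (ρ : Representation c a d H) (s : List Param) : ∀ p, Good a d (p :: s) →
    ket ρ (ketDWord c p s) = ρ.op 1 1 p (ρ.ketVec s) := by
  induction s with
  | nil =>
    intro p hp
    obtain ⟨h1, -⟩ := hp.2 p (by simp)
    simp [ketDWord, ket, Representation.op, Representation.ketVec, ρ.D_vac, smul_smul, h1]
  | cons q s ih =>
    intro p hp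
    rw [Representation.ketVec, DB ρ p q (fst_ne hp), ketDWord, map_add, map_smul, map_smul,
      ket_cons, ket_cons, ih p hp.drop, ih q hp.tail]

theorem bra_D (ρ : Representation c a d H) (s : List Param) : ∀ p, Good a d (p :: s) →
    bra ρ (braDWord c p s) = ρ.braVec s ∘ₗ ρ.op 1 1 p := by
  induction s with
  | nil =>
    intro p hp
    obtain ⟨h1, -⟩ := hp.2 p (by simp)
    ext v
    have := LinearMap.congr_fun (ρ.covac_D p.1) v
    simp at this
    simp [braDWord, bra, Representation.op, Representation.braVec, this, h1]
  | cons q s ih =>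
    intro p hp
    ext v
    simp only [braDWord, map_add, map_smul, bra_cons, ih p hp.drop, ih q hp.tail,
      Representation.braVec, LinearMap.comp_apply, LinearMap.add_apply, LinearMap.smul_apply,
      CD ρ p q (fst_ne hp) v]

theorem ket_AD (ρ : Representation c a d H) (s : List Param) (p q : Param)
    (h : Good a d (p :: q :: s)) :
    ket ρ (ketA c p (ketDWord c q s)) = ρ.op 0 0 p (ρ.op 1 1 q (ρ.ketVec s)) := by
  rw [← ket_D ρ s q h.tail]
  refine eq_on (L := ket ρ ∘ₗ ketA c p) (L' := ρ.op 0 0 p ∘ₗ ket ρ) (ketD_mem c s q) ?_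
  intro w' hw'
  simp only [LinearMap.comp_apply, ketA_single, ket_single]
  exact ket_A ρ w' p (h.mono (cons_sub p hw'))

theorem Good.swap {p q : Param} {s : List Param} (h : Good a d (p :: q :: s)) :
    Good a d (q :: p :: s) := h.mono (List.Perm.swap _ _ _).subperm

theorem ket_C (ρ : Representation c a d H) (p : Param) (s : List Param)
    (hp : Good a d (p :: s)) : ket ρ (ketCWord c p s) = ρ.op 1 0 p (ρ.ketVec s) := by
  induction s with
  | nil => simp [ketCWord, Representation.op, Representation.ketVec, ρ.C_vac]
  | cons q s ih =>
    rw [Representation.ketVec, CB ρ p q (fst_ne hp), ketCWord, map_add, map_smul, map_sub,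
      ket_cons, ih hp.drop, ket_AD ρ s p q hp, ket_AD ρ s q p hp.swap]

theorem ket_Psi (ρ : Representation c a d H) (s : List Param) (h : Good a d s) :
    ket ρ (ketPsiWord c s) = ρ.Psi (ρ.ketVec s) := by
  induction s with
  | nil => simp [ketPsiWord, Representation.ketVec, ρ.psi_vac]
  | cons q s ih =>
    have h1 := LinearMap.congr_fun (ρ.psi_B q.1) (ρ.ketVec s)
    simp only [LinearMap.sub_apply, Module.End.mul_apply, LinearMap.smul_apply] at h1
    rw [Representation.ketVec, ketPsiWord, map_sub, map_smul, ket_cons, ih h.tail, ket_A ρ s q h]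
    simp only [Representation.op, LinearMap.smul_apply, map_smul]
    rw [eq_add_of_sub_eq h1]
    module

theorem bra_Psi (ρ : Representation c a d H) (s : List Param) (h : Good a d s) :
    bra ρ (braPsiDagWord c s) = ρ.braVec s ∘ₗ ρ.PsiDag := by
  induction s with
  | nil => simp [braPsiDagWord, Representation.braVec, ρ.covac_psiDag]
  | cons q s ih =>
    ext v
    have h1 := LinearMap.congr_fun (ρ.C_psiDag q.1) v
    simp only [LinearMap.sub_apply, Module.End.mul_apply, LinearMap.smul_apply] at h1
    simp only [Representation.braVec, braPsiDagWord, map_add, map_smul, bra_cons, ih h.tail,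
      bra_D ρ s q h, LinearMap.add_apply, LinearMap.smul_apply, LinearMap.comp_apply,
      Representation.op, eq_add_of_sub_eq h1]
    ring

theorem ket_Psi_pow (ρ : Representation c a d H) (s : List Param) (h : Good a d s) (k : ℕ) :
    (ketPsi c ^ k) (Finsupp.single s 1) ∈ sup s ∧
      ket ρ ((ketPsi c ^ k) (Finsupp.single s 1)) = (ρ.Psi ^ k) (ρ.ketVec s) := by
  induction k with
  | zero =>
    exact ⟨Finsupp.single_mem_supported ℂ _ (List.Subperm.refl _), by simp [ket_single]⟩
  | succ k ih =>
    have h1 : ∀ w', ketPsi c (Finsupp.single w' 1) = ketPsiWord c w' := fun w' => by simp [ketPsi]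
    rw [pow_succ', pow_succ', Module.End.mul_apply, Module.End.mul_apply, ← ih.2]
    refine ⟨map_mem ih.1 fun w' hw' => ?_,
      eq_on (L := ket ρ ∘ₗ ketPsi c) (L' := ρ.Psi ∘ₗ ket ρ) ih.1 fun w' hw' => ?_⟩
    · rw [h1]; exact sup_mono hw' (ketPsi_mem c w')
    · simp only [LinearMap.comp_apply, h1, ket_single]; exact ket_Psi ρ w' (h.mono hw')

theorem bra_Psi_pow (ρ : Representation c a d H) (s : List Param) (h : Good a d s) (k : ℕ) :
    (braPsiDag c ^ k) (Finsupp.single s 1) ∈ sup s ∧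
      bra ρ ((braPsiDag c ^ k) (Finsupp.single s 1)) = ρ.braVec s ∘ₗ (ρ.PsiDag ^ k) := by
  induction k with
  | zero =>
    exact ⟨Finsupp.single_mem_supported ℂ _ (List.Subperm.refl _), by
      simp [bra_single, Module.End.one_eq_id]⟩
  | succ k ih =>
    have h1 : ∀ w', braPsiDag c (Finsupp.single w' 1) = braPsiDagWord c w' :=
      fun w' => by simp [braPsiDag]
    rw [pow_succ', pow_succ, Module.End.mul_apply, Module.End.mul_eq_comp, ← LinearMap.comp_assoc,
      ← ih.2]
    refine ⟨map_mem ih.1 fun w' hw' => ?_,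
      eq_on (L := bra ρ ∘ₗ braPsiDag c) (L' := ρ.PsiDag.lcomp ℂ ℂ ∘ₗ bra ρ) ih.1 fun w' hw' => ?_⟩
    · rw [h1]; exact sup_mono hw' (braPsiDag_mem c w')
    · simp only [LinearMap.comp_apply, h1, bra_single]
      exact bra_Psi ρ w' (h.mono hw')

theorem braWordEval_eq (ρ : Representation c a d H) (s : List Param) :
    ∀ (t : List Param) (v : Ket), Good a d (s ++ t) → v ∈ sup t →
      braWordEval c s v = ρ.braVec s (ket ρ v) := by
  induction s with
  | nil =>
    intro t v _ _
    have : (Finsupp.lapply [] : Ket →ₗ[ℂ] ℂ) = ρ.covac ∘ₗ ket ρ := by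
      ext w
      cases w with
      | nil => simp [ket, Representation.ketVec, ρ.covac_vac]
      | cons q w =>
        have := LinearMap.congr_fun (ρ.covac_B q.1) (ρ.ketVec w)
        simp at this
        simp [ket, Representation.ketVec, Representation.op, this]
    exact LinearMap.congr_fun this v
  | cons p s ih =>
    intro t v h hv
    have h1 : ∀ w', ketC c p (Finsupp.single w' 1) = ketCWord c p w' := fun w' => by simp [ketC]
    have hpt : (p :: t).Subperm (p :: s ++ t) := cons_sub p (List.sublist_append_right s t).subperm
    simp only [braWordEval, Representation.braVec, LinearMap.comp_apply]
    rw [ih (p :: t) (ketC c p v) (h.mono List.perm_middle.subperm)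
      (map_mem hv fun w' hw' => by rw [h1]; exact sup_mono (cons_sub p hw') (ketC_mem c p w'))]
    congr 1
    refine eq_on (L := ket ρ ∘ₗ ketC c p) (L' := ρ.op 1 0 p ∘ₗ ket ρ) hv fun w' hw' => ?_
    simp only [LinearMap.comp_apply, h1, ket_single]
    exact ket_C ρ p w' (h.mono ((cons_sub p hw').trans hpt))

theorem pairing_eq (ρ : Representation c a d H) (s t : List Param) (h : Good a d (s ++ t))
    (u v : List Param →₀ ℂ) (hu : u ∈ sup s) (hv : v ∈ sup t) :
    pairing c u v = bra ρ u (ket ρ v) := by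
  refine eq_on (L := (pairing c).flip v) (L' := (bra ρ).flip (ket ρ v)) hu fun w' hw' => ?_
  simp only [LinearMap.flip_apply, bra_single, pairing, Finsupp.linearCombination_single, one_smul]
  exact braWordEval_eq ρ w' t v (h.mono ((List.subperm_append_right t).2 hw')) hv

end Aux

/-- In every representation, and for pairwise distinct spectral parameters, the matrix element
`⟨0| ∏ ℂ(x^C_j) (Ψ†)^k Ψ^k ∏ 𝔹(x^B_j) |0⟩` equals `offShell` at `l = a / d`. -/
theorem offShell_eq {c : ℝ} {a d : ℂ → ℂ} {H : Type*} [AddCommGroup H] [Module ℂ H]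
    (ρ : Representation c a d H) (k : ℕ) {N : ℕ} (xC xB lC lB : Fin N → ℂ)
    (hd : (List.ofFn xC ++ List.ofFn xB).Nodup)
    (hC : ∀ j, d (xC j) ≠ 0 ∧ lC j = a (xC j) / d (xC j))
    (hB : ∀ j, d (xB j) ≠ 0 ∧ lB j = a (xB j) / d (xB j)) :
    ρ.braVec (word xC lC) ((ρ.PsiDag ^ k) ((ρ.Psi ^ k) (ρ.ketVec (word xB lB))))
      = offShell c k xC xB lC lB := by
  have h : Aux.Good a d (word xC lC ++ word xB lB) := by
    refine ⟨by simpa [word, List.map_ofFn, Function.comp_def] using hd, fun r hr => ?_⟩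
    rcases List.mem_append.1 hr with hr | hr
    · obtain ⟨j, rfl⟩ := (List.mem_ofFn' _ _).1 hr
      exact hC j
    · obtain ⟨j, rfl⟩ := (List.mem_ofFn' _ _).1 hr
      exact hB j
  have h1 := Aux.bra_Psi_pow ρ _ (h.mono (List.sublist_append_left _ _).subperm) k
  have h2 := Aux.ket_Psi_pow ρ _ (h.mono (List.sublist_append_right _ _).subperm) k
  rw [offShell, Aux.pairing_eq ρ _ _ h _ _ h1.1 h2.1, h1.2, h2.2]
  rfl

/-! ## On-shell form factors and mean values -/

/-- The values `l_j` determined by the Bethe equations `l_j ∏_{m ≠ j} S(x_m - x_j) = 1`. -/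
def betheL (c : ℝ) {N : ℕ} (x : Fin N → ℂ) (j : Fin N) : ℂ :=
  (∏ m ∈ Finset.univ.erase j, sMatrix c (x m - x j))⁻¹

/-- The on-shell matrix element (form factor) `𝔽^k_{2N}({x^C} | {x^B})`: in the off-shell matrix
element the variables `l` are expressed through the rapidities by the Bethe equations. -/
def formFactor (c : ℝ) (k : ℕ) {N : ℕ} (xC xB : Fin N → ℂ) : ℂ :=
  offShell c k xC xB (betheL c xC) (betheL c xB)

/-- `v` is the symmetric diagonal limit (the irreducible part) `𝔽^k_{2N,s}({x})`. -/
def HasSymmetricLimit (c : ℝ) (k : ℕ) {N : ℕ} (x : Fin N → ℂ) (v : ℂ) : Prop :=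
  Filter.Tendsto (fun ε : ℂ => formFactor c k (fun j => x j + ε) x)
    (nhdsWithin 0 {0}ᶜ) (nhds v)

/-- `ell` is a vacuum eigenvalue ratio with `ell(x_j) = l_j` and `z(x_j) = z_j`, where
`z = i (d/dx) log ell`. -/
def IsVacuumRatio {N : ℕ} (x l z : Fin N → ℂ) (ell : ℂ → ℂ) : Prop :=
  ∀ j, DifferentiableAt ℂ ell (x j) ∧ ell (x j) = l j ∧ Complex.I * logDeriv ell (x j) = z j

/-- `v` is the diagonal limit `M^k_N({x}, {l}, {z})`, a function of `3N` variables: for functions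
`ell` with the data `l`, `z` at the points `x_j`, the off-shell matrix element with
`l^C_j = ell(x^C_j)` and `l^B_j = ell(x_j)` tends to `v` as all `x^C_j → x_j`, `x^C_j ≠ x_j`,
whatever the function `ell`. -/
def HasDiagonalLimit (c : ℝ) (k : ℕ) {N : ℕ} (x l z : Fin N → ℂ) (v : ℂ) : Prop :=
  (∃ ell, IsVacuumRatio x l z ell) ∧
  ∀ ell, IsVacuumRatio x l z ell →
    Filter.Tendsto (fun y : Fin N → ℂ => offShell c k y x (fun j => ell (y j)) l)
      (nhdsWithin x {y | ∀ j, y j ≠ x j}) (nhds v)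

/-- `v` is the on-shell mean value `⟨𝒪_k⟩_N({x}, {z})`: the diagonal limit, with the `l_j` given by
the Bethe equations, as a function of the `2N` variables `x_j` and `z_j`. -/
def HasOnShellMeanValue (c : ℝ) (k : ℕ) {N : ℕ} (x z : Fin N → ℂ) (v : ℂ) : Prop :=
  HasDiagonalLimit c k x (betheL c x) z v

end BoseABA

end

/-! Both sides are limits of the same function, the off-shell matrix element with `l^B = betheL c
x`, along different paths to the diagonal. The matrix element turns out to be polynomial in the
parameters, in the inverse differences of rapidities from different pairs, and in the quotients
`(l^C_j - l^B_j) / (x^C_j - x^B_j)`. Its diagonal limit therefore depends only on `x`, on `l` and on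
the limits of these quotients. On the symmetric path the quotients vanish identically, because the
Bethe values are invariant under a common translation. For the mean value they tend to `ell' (x_j)`,
which is zero because `z_j = 0` and `l_j ≠ 0`.

The regularity is the main point. All poles come from `g`. Since `f = 1 + g` and `g` is odd, every
`g(p,q)` in the exchange relations multiplies an expression antisymmetrized in `p` and `q`. If `p`
and `q` form a pair, the product is a divided difference, and the regular functions are closed under
divided differences (`IsRegular.exchange_and_divided`, `IsRegular.g_mul_sub`). To run the induction
over words, the operators to the left of the current one are absorbed in a functional that does not
involve the remaining parameters (`IsRegularFunctional`); this makes the antisymmetry visible. The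
outcome is `exists_regular_offShell`, and `exists_offShell_limit` draws the limit from it. -/

namespace BoseABA

open Filter Topology

/-! ### Pairs of parameters and their exchange -/

/-- A choice of parameters for `N` pairs of operators; `(j, true)` labels the `j`-th `ℂ` and
`(j, false)` the `j`-th `𝔹`. -/
abbrev Conf (N : ℕ) := Fin N × Bool → Param

namespace Conf

variable {N : ℕ}

/-- The spectral parameters are pairwise distinct. -/
def IsDistinct (P : Conf N) : Prop := ∀ i i', i ≠ i' → (P i).1 ≠ (P i').1

/-- The difference of the spectral parameters of the `j`-th pair. -/
def gap (j : Fin N) (P : Conf N) : ℂ := (P (j, true)).1 - (P (j, false)).1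

/-- The difference of the vacuum eigenvalue ratios of the `j`-th pair. -/
def ratioGap (j : Fin N) (P : Conf N) : ℂ := (P (j, true)).2 - (P (j, false)).2

/-- The exchange of the two members of the `j`-th pair. -/
def exchange (j : Fin N) : Equiv.Perm (Fin N × Bool) := Equiv.swap (j, true) (j, false)

theorem IsDistinct.comp {P : Conf N} (hP : P.IsDistinct) (π : Equiv.Perm (Fin N × Bool)) :
    IsDistinct (P ∘ π) := fun _ _ h => hP _ _ (π.injective.ne h)

theorem IsDistinct.gap_ne {P : Conf N} (hP : P.IsDistinct) (j : Fin N) : gap j P ≠ 0 :=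
  sub_ne_zero.2 (hP _ _ (by simp))

theorem exchange_fst (j : Fin N) (i : Fin N × Bool) : (exchange j i).1 = i.1 := by
  unfold exchange
  rw [Equiv.swap_apply_def]
  split_ifs with h h' <;> simp [*]

/-- One sign `δ ∈ {1, -1, 0}`, independent of `P`, serves both entries. So the divided difference of
a rapidity is a constant, and that of an `l` is a constant times the difference quotient. -/
theorem exists_sub_exchange (j : Fin N) (i : Fin N × Bool) :
    ∃ δ : ℂ, ∀ P : Conf N, (P i).1 - (P (exchange j i)).1 = δ * gap j P ∧
      (P i).2 - (P (exchange j i)).2 = δ * ratioGap j P := by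
  by_cases h : i = (j, true)
  · subst h
    exact ⟨1, fun P => by simp [exchange, gap, ratioGap]⟩
  by_cases h' : i = (j, false)
  · subst h'
    exact ⟨-1, fun P => by simp [exchange, gap, ratioGap]⟩
  · exact ⟨0, fun P => by simp [exchange, Equiv.swap_apply_of_ne_of_ne h h']⟩

end Conf

/-! ### Regular functions and divided differences -/

open Conf

variable {N : ℕ}

/-- Functions of the parameters that are polynomial in the parameters, in the inverse differences
of spectral parameters from different pairs, and in the difference quotients
`(l_C - l_B) / (x_C - x_B)` of each pair. -/
inductive IsRegular : (Conf N → ℂ) → Prop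
  | const (z : ℂ) : IsRegular fun _ => z
  | fst (i : Fin N × Bool) : IsRegular fun P => (P i).1
  | snd (i : Fin N × Bool) : IsRegular fun P => (P i).2
  | inv (i i' : Fin N × Bool) (h : i.1 ≠ i'.1) : IsRegular fun P => ((P i).1 - (P i').1)⁻¹
  | quotient (j : Fin N) : IsRegular fun P => ratioGap j P / gap j P
  | add {F G : Conf N → ℂ} : IsRegular F → IsRegular G → IsRegular fun P => F P + G P
  | mul {F G : Conf N → ℂ} : IsRegular F → IsRegular G → IsRegular fun P => F P * G P
  -- Values at coinciding rapidities are ignored: there division by zero returns a default value,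
  -- and the limits never visit such points.
  | congr {F G : Conf N → ℂ} : IsRegular F → (∀ P : Conf N, P.IsDistinct → F P = G P) →
      IsRegular G

namespace IsRegular

theorem sub {F G : Conf N → ℂ} (hF : IsRegular F) (hG : IsRegular G) :
    IsRegular fun P => F P - G P :=
  (hF.add ((const (-1)).mul hG)).congr fun P _ => by ring

/-- Regularity is preserved by the exchange of a pair and by the divided difference. -/
theorem exchange_and_divided (j : Fin N) {F : Conf N → ℂ} (hF : IsRegular F) :
    IsRegular (fun P => F (P ∘ exchange j)) ∧
      IsRegular fun P => (F P - F (P ∘ exchange j)) / gap j P := by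
  induction hF with
  | const z => exact ⟨const z, (const 0).congr fun P _ => by simp⟩
  | fst i =>
    obtain ⟨δ, hδ⟩ := exists_sub_exchange j i
    refine ⟨fst _, (const δ).congr fun P hP => ?_⟩
    simp only [Function.comp_apply, (hδ P).1]
    rw [mul_div_cancel_right₀ _ (hP.gap_ne j)]
  | snd i =>
    obtain ⟨δ, hδ⟩ := exists_sub_exchange j i
    refine ⟨snd _, ((const δ).mul (quotient j)).congr fun P hP => ?_⟩
    simp only [Function.comp_apply, (hδ P).2]
    ring
  | inv i i' h =>
    obtain ⟨δ, hδ⟩ := exists_sub_exchange j i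
    obtain ⟨δ', hδ'⟩ := exists_sub_exchange j i'
    have h' : (exchange j i).1 ≠ (exchange j i').1 := by rwa [exchange_fst, exchange_fst]
    -- An exchange stays inside a pair, so both denominators still join different pairs. The
    -- numerator of the difference of inverses is `(δ' - δ)` times the gap.
    refine ⟨inv _ _ h',
      ((const (δ' - δ)).mul ((inv _ _ h).mul (inv _ _ h'))).congr fun P hP => ?_⟩
    have h1 : (P i).1 - (P i').1 ≠ 0 := sub_ne_zero.2 (hP _ _ fun e => h (by rw [e]))
    have h2 : (P (exchange j i)).1 - (P (exchange j i')).1 ≠ 0 :=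
      sub_ne_zero.2 (hP _ _ fun e => h' (by rw [e]))
    have h3 := hP.gap_ne j
    simp only [Function.comp_apply]
    rw [eq_div_iff h3, inv_sub_inv h1 h2, eq_div_iff (mul_ne_zero h1 h2)]
    field_simp
    linear_combination (hδ P).1 - (hδ' P).1
  | quotient j' =>
    -- Numerator and denominator change sign together, so the quotient is symmetric and its divided
    -- difference is zero. Hence no higher quotients arise and the class is closed.
    have key : ∀ P : Conf N, ratioGap j' (P ∘ exchange j) / gap j' (P ∘ exchange j)
        = ratioGap j' P / gap j' P := by
      intro P
      by_cases h : j' = j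
      · subst h
        simp only [gap, ratioGap, exchange, Function.comp_apply, Equiv.swap_apply_left,
          Equiv.swap_apply_right]
        rw [← neg_sub, ← neg_sub (P (j', true)).1, neg_div_neg_eq]
      · have : ∀ b, exchange j (j', b) = (j', b) := fun b =>
          Equiv.swap_apply_of_ne_of_ne (by simp [h]) (by simp [h])
        simp only [gap, ratioGap, Function.comp_apply, this]
    exact ⟨(quotient j').congr fun P _ => (key P).symm, (const 0).congr fun P _ => by simp [key]⟩
  | add _ _ ihF ihG =>
    exact ⟨ihF.1.add ihG.1, (ihF.2.add ihG.2).congr fun P _ => by ring⟩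
  | mul hF _ ihF ihG =>
    -- Discrete Leibniz rule: `F G - F' G' = F (G - G') + (F - F') G'`.
    exact ⟨ihF.1.mul ihG.1, ((hF.mul ihG.2).add (ihF.2.mul ihG.1)).congr fun P _ => by ring⟩
  | congr _ h ih =>
    exact ⟨ih.1.congr fun P hP => h _ (hP.comp _),
      ih.2.congr fun P hP => by rw [h P hP, h _ (hP.comp _)]⟩

/-- The pole of `g` at coinciding parameters cancels in an antisymmetrized regular function. -/
theorem g_mul_sub (c : ℝ) {p q : Fin N × Bool} (hpq : p ≠ q) {F G : Conf N → ℂ}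
    (hF : IsRegular F) (hG : IsRegular G) (h : ∀ P, F (P ∘ Equiv.swap p q) = G P) :
    IsRegular fun P => g c (P p).1 (P q).1 * (F P - G P) := by
  by_cases h1 : p.1 = q.1
  -- Within a pair the swap is `exchange j`, and the product is `± i c` times a divided difference.
  -- Between different pairs, `g` itself is regular.
  · obtain ⟨j, b⟩ := p
    obtain ⟨j', b'⟩ := q
    obtain rfl : j = j' := h1
    have hb : b ≠ b' := fun e => hpq (by rw [e])
    have hd := (hF.exchange_and_divided j).2
    cases b <;> cases b'
    · exact absurd rfl hb
    · refine ((const (-(Complex.I * c))).mul hd).congr fun P hP => ?_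
      rw [exchange, Equiv.swap_comm, h, g, gap, ← neg_sub (P (j, true)).1, div_neg]
      ring
    · refine ((const (Complex.I * c)).mul hd).congr fun P hP => ?_
      rw [exchange, h, g, gap]
      ring
    · exact absurd rfl hb
  · exact (((const (Complex.I * c)).mul (inv p q h1)).mul (hF.sub hG)).congr fun P _ => by
      rw [g]; ring

/-- A regular function has a limit at a diagonal point at which the difference quotients of the
vacuum eigenvalue ratios vanish, whatever the path. -/
theorem exists_tendsto {x : Fin N → ℂ} (hx : Function.Injective x) (l : Fin N → ℂ)
    {F : Conf N → ℂ} (hF : IsRegular F) :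
    ∃ v, ∀ {α : Type} (φ : Filter α) (P : α → Conf N), (∀ᶠ a in φ, (P a).IsDistinct) →
      (∀ i, Tendsto (fun a => (P a i).1) φ (𝓝 (x i.1))) →
      (∀ i, Tendsto (fun a => (P a i).2) φ (𝓝 (l i.1))) →
      (∀ j, Tendsto (fun a => ratioGap j (P a) / gap j (P a)) φ (𝓝 0)) →
      Tendsto (fun a => F (P a)) φ (𝓝 v) := by
  induction hF with
  | const z => exact ⟨z, fun _ _ _ _ _ _ => tendsto_const_nhds⟩
  | fst i => exact ⟨_, fun _ _ _ h _ _ => h i⟩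
  | snd i => exact ⟨_, fun _ _ _ _ h _ => h i⟩
  | inv i i' h =>
    exact ⟨_, fun _ _ _ h1 _ _ => ((h1 i).sub (h1 i')).inv₀ (sub_ne_zero.2 (hx.ne h))⟩
  | quotient j => exact ⟨_, fun _ _ _ _ _ h => h j⟩
  | add _ _ ihF ihG =>
    obtain ⟨v, hv⟩ := ihF
    obtain ⟨w, hw⟩ := ihG
    exact ⟨v + w, fun φ P h1 h2 h3 h4 => (hv φ P h1 h2 h3 h4).add (hw φ P h1 h2 h3 h4)⟩
  | mul _ _ ihF ihG =>
    obtain ⟨v, hv⟩ := ihF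
    obtain ⟨w, hw⟩ := ihG
    exact ⟨v * w, fun φ P h1 h2 h3 h4 => (hv φ P h1 h2 h3 h4).mul (hw φ P h1 h2 h3 h4)⟩
  | congr _ h ih =>
    obtain ⟨v, hv⟩ := ih
    exact ⟨v, fun φ P h1 h2 h3 h4 => (hv φ P h1 h2 h3 h4).congr' (h1.mono fun a ha => h _ ha)⟩

end IsRegular

/-! ### Functionals and the exchange relations -/

/-- Shows that `f` and `g` have the same residue, which is what lets their poles combine. At `x = y`
it fails, since both then take the default value `0`. -/
theorem f_eq_one_add_g (c : ℝ) {x y : ℂ} (h : x ≠ y) : f c x y = 1 + g c x y := by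
  rw [f, g, add_div, div_self (sub_ne_zero.2 h)]

theorem map_comp_swap {p q : Fin N × Bool} {t : List (Fin N × Bool)} (hp : p ∉ t) (hq : q ∉ t)
    (P : Conf N) : t.map (P ∘ Equiv.swap p q) = t.map P := by
  refine List.map_congr_left fun i hi => ?_
  rw [Function.comp_apply, Equiv.swap_apply_of_ne_of_ne] <;> rintro rfl <;> contradiction

/-- A family of functionals that involves only parameters with labels in `Z`, and that is regular
on words in the other parameters. -/
structure IsRegularFunctional (Z : Set (Fin N × Bool))
    (Λ : Conf N → (List Param →₀ ℂ) →ₗ[ℂ] ℂ) : Prop where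
  swap : ∀ p q, p ∉ Z → q ∉ Z → ∀ P, Λ (P ∘ Equiv.swap p q) = Λ P
  regular : ∀ t : List (Fin N × Bool), t.Nodup → (∀ i ∈ t, i ∉ Z) →
    IsRegular fun P => Λ P (Finsupp.single (t.map P) 1)

namespace IsRegularFunctional

variable {Z : Set (Fin N × Bool)} {Λ : Conf N → (List Param →₀ ℂ) →ₗ[ℂ] ℂ}

/-- Composition with an operator that carries one parameter. -/
theorem comp (h : IsRegularFunctional Z Λ) (p : Fin N × Bool)
    (T : Param → (List Param →₀ ℂ) →ₗ[ℂ] (List Param →₀ ℂ))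
    (hT : ∀ t : List (Fin N × Bool), (p :: t).Nodup → (∀ i ∈ p :: t, i ∉ Z) →
      IsRegular fun P => Λ P (T (P p) (Finsupp.single (t.map P) 1))) (hp : p ∉ Z) :
    IsRegularFunctional (insert p Z) fun P => Λ P ∘ₗ T (P p) where
  swap r s hr hs P := by
    simp only [Set.mem_insert_iff, not_or] at hr hs
    simp only [h.swap r s hr.2 hs.2 P, Function.comp_apply,
      Equiv.swap_apply_of_ne_of_ne (Ne.symm hr.1) (Ne.symm hs.1)]
  regular t ht htZ := by
    refine hT t (List.nodup_cons.2 ⟨fun hm => htZ p hm (Set.mem_insert _ _), ht⟩) ?_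
    intro i hi
    rcases List.mem_cons.1 hi with rfl | hi
    · exact hp
    · exact fun hz => htZ i hi (Set.mem_insert_of_mem _ hz)

theorem comp_cons (h : IsRegularFunctional Z Λ) {p : Fin N × Bool} (hp : p ∉ Z) :
    IsRegularFunctional (insert p Z) fun P => Λ P ∘ₗ cons (P p) :=
  h.comp p cons (fun t ht htZ => by
    simpa only [Aux.cons_single, List.map_cons] using h.regular _ ht htZ) hp

theorem forall_notMem_insert {q : Fin N × Bool} {t : List (Fin N × Bool)}
    (ht : q ∉ t) (htZ : ∀ i ∈ t, i ∉ Z) : ∀ i ∈ t, i ∉ insert q Z := by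
  intro i hi hz
  rcases Set.mem_insert_iff.1 hz with rfl | hz
  · exact ht hi
  · exact htZ i hi hz

/-- Regularity of the common recursion of `𝔸` and `𝔻`. -/
theorem regular_of_recursion (W : Param → List Param → (List Param →₀ ℂ)) (c : ℝ) (κ : ℂ)
    (b : Param → ℂ) (hb : ∀ p : Fin N × Bool, IsRegular fun P => b (P p))
    (h_nil : ∀ p, W p [] = Finsupp.single [] (b p))
    (h_cons : ∀ p q s, p.1 ≠ q.1 → W p (q :: s)
      = cons q (W p s) + (κ * g c p.1 q.1) • (cons q (W p s) - cons p (W q s)))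
    (t : List (Fin N × Bool)) : ∀ (p : Fin N × Bool) (Z : Set (Fin N × Bool))
      (Λ : Conf N → (List Param →₀ ℂ) →ₗ[ℂ] ℂ), IsRegularFunctional Z Λ → (p :: t).Nodup →
      (∀ i ∈ p :: t, i ∉ Z) → IsRegular fun P => Λ P (W (P p) (t.map P)) := by
  induction t with
  | nil =>
    intro p Z Λ h _ _
    refine ((hb p).mul (h.regular [] List.nodup_nil (by simp))).congr fun P _ => ?_
    simp only [List.map_nil, h_nil]
    rw [← smul_eq_mul, ← map_smul, Finsupp.smul_single, smul_eq_mul, mul_one]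
  | cons q t ih =>
    intro p Z Λ h ht htZ
    simp only [List.nodup_cons, List.mem_cons, not_or] at ht
    simp only [List.forall_mem_cons] at htZ
    obtain ⟨⟨hpq, hpt⟩, hqt, htt⟩ := ht
    obtain ⟨hpZ, hqZ, htZ⟩ := htZ
    -- Once the outer operator is absorbed in the functional, its label joins `Z` and the shorter
    -- word remains. The two terms obtained in this way are interchanged by swapping `p` and `q`.
    have hF := ih p _ _ (h.comp_cons hqZ) (List.nodup_cons.2 ⟨hpt, htt⟩)
      (forall_notMem_insert (by simp [Ne.symm hpq, hqt]) (List.forall_mem_cons.2 ⟨hpZ, htZ⟩))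
    have hG := ih q _ _ (h.comp_cons hpZ) (List.nodup_cons.2 ⟨hqt, htt⟩)
      (forall_notMem_insert (by simp [hpq, hpt]) (List.forall_mem_cons.2 ⟨hqZ, htZ⟩))
    refine (hF.add ((IsRegular.const κ).mul (IsRegular.g_mul_sub c hpq hF hG fun P => ?_))).congr
      fun P hP => ?_
    · simp only [LinearMap.comp_apply, h.swap p q hpZ hqZ, map_comp_swap hpt hqt,
        Function.comp_apply, Equiv.swap_apply_left, Equiv.swap_apply_right]
    · simp only [List.map_cons, h_cons _ _ _ (hP p q hpq), map_add, map_smul, map_sub,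
        LinearMap.comp_apply, smul_eq_mul, mul_assoc]

theorem ketAWord_regular (c : ℝ) (h : IsRegularFunctional Z Λ) {p : Fin N × Bool}
    {t : List (Fin N × Bool)} (ht : (p :: t).Nodup) (htZ : ∀ i ∈ p :: t, i ∉ Z) :
    IsRegular fun P => Λ P (ketAWord c (P p) (t.map P)) := by
  refine regular_of_recursion (ketAWord c) c 1 Prod.snd IsRegular.snd (fun p => rfl) ?_
    t p Z Λ h ht htZ
  intro p q s hpq
  rw [ketAWord, f_eq_one_add_g c hpq, Aux.g_swap c p.1 q.1]
  module

/-- The relation for `𝔻` is that for `𝔸` with the arguments of `f` and `g` reversed; as `g` is odd,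
this only turns `κ = 1` into `κ = -1`. -/
theorem ketDWord_regular (c : ℝ) (h : IsRegularFunctional Z Λ) {p : Fin N × Bool}
    {t : List (Fin N × Bool)} (ht : (p :: t).Nodup) (htZ : ∀ i ∈ p :: t, i ∉ Z) :
    IsRegular fun P => Λ P (ketDWord c (P p) (t.map P)) := by
  refine regular_of_recursion (ketDWord c) c (-1) (fun _ => 1) (fun _ => IsRegular.const 1)
    (fun p => rfl) ?_ t p Z Λ h ht htZ
  intro p q s hpq
  rw [ketDWord, f_eq_one_add_g c hpq.symm, Aux.g_swap c p.1 q.1]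
  module

theorem comp_ketA (c : ℝ) (h : IsRegularFunctional Z Λ) {p : Fin N × Bool} (hp : p ∉ Z) :
    IsRegularFunctional (insert p Z) fun P => Λ P ∘ₗ ketA c (P p) :=
  h.comp p (ketA c) (fun t ht htZ => by
    simpa only [Aux.ketA_single] using h.ketAWord_regular c ht htZ) hp

/-- The commutator of `ℂ(p)` with `𝔹(q)` is `g(p,q)` times `𝔸(p) 𝔻(q) - 𝔸(q) 𝔻(p)`, which is already
antisymmetric. The remaining term `𝔹(q) ℂ(p)` falls to the induction, with `𝔹(q)` absorbed in the
functional. -/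
theorem ketCWord_regular (c : ℝ) (p : Fin N × Bool) (t : List (Fin N × Bool)) :
    ∀ (Z : Set (Fin N × Bool)) (Λ : Conf N → (List Param →₀ ℂ) →ₗ[ℂ] ℂ),
      IsRegularFunctional Z Λ → (p :: t).Nodup → (∀ i ∈ p :: t, i ∉ Z) →
      IsRegular fun P => Λ P (ketCWord c (P p) (t.map P)) := by
  induction t with
  | nil =>
    intro Z Λ _ _ _
    exact (IsRegular.const 0).congr fun P _ => by simp [ketCWord]
  | cons q t ih =>
    intro Z Λ h ht htZ
    simp only [List.nodup_cons, List.mem_cons, not_or] at ht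
    simp only [List.forall_mem_cons] at htZ
    obtain ⟨⟨hpq, hpt⟩, hqt, htt⟩ := ht
    obtain ⟨hpZ, hqZ, htZ⟩ := htZ
    have hp : ∀ i ∈ p :: t, i ∉ insert q Z :=
      forall_notMem_insert (by simp [Ne.symm hpq, hqt]) (List.forall_mem_cons.2 ⟨hpZ, htZ⟩)
    have hq : ∀ i ∈ q :: t, i ∉ insert p Z :=
      forall_notMem_insert (by simp [hpq, hpt]) (List.forall_mem_cons.2 ⟨hqZ, htZ⟩)
    have hC := ih _ _ (h.comp_cons hqZ) (List.nodup_cons.2 ⟨hpt, htt⟩) hp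
    have hF := (h.comp_ketA c hpZ).ketDWord_regular c (List.nodup_cons.2 ⟨hqt, htt⟩) hq
    have hG := (h.comp_ketA c hqZ).ketDWord_regular c (List.nodup_cons.2 ⟨hpt, htt⟩) hp
    refine (hC.add (IsRegular.g_mul_sub c hpq hF hG fun P => ?_)).congr fun P _ => ?_
    · simp only [LinearMap.comp_apply, h.swap p q hpZ hqZ, map_comp_swap hpt hqt,
        Function.comp_apply, Equiv.swap_apply_left, Equiv.swap_apply_right]
    · simp only [List.map_cons, ketCWord, map_add, map_smul, map_sub, LinearMap.comp_apply,
        smul_eq_mul]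

theorem comp_ketC (c : ℝ) (h : IsRegularFunctional Z Λ) {p : Fin N × Bool} (hp : p ∉ Z) :
    IsRegularFunctional (insert p Z) fun P => Λ P ∘ₗ ketC c (P p) :=
  h.comp p (ketC c) (fun t ht htZ => by
    simpa only [ketC, Finsupp.linearCombination_single, one_smul]
      using ketCWord_regular c p t Z Λ h ht htZ) hp

/-- Composition with an operator that carries no parameter. -/
theorem comp_pow (T : (List Param →₀ ℂ) →ₗ[ℂ] (List Param →₀ ℂ))
    (hT : ∀ Λ : Conf N → (List Param →₀ ℂ) →ₗ[ℂ] ℂ, IsRegularFunctional Z Λ →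
      ∀ t : List (Fin N × Bool), t.Nodup → (∀ i ∈ t, i ∉ Z) →
        IsRegular fun P => Λ P (T (Finsupp.single (t.map P) 1)))
    (h : IsRegularFunctional Z Λ) (k : ℕ) : IsRegularFunctional Z fun P => Λ P ∘ₗ (T ^ k) := by
  induction k with
  | zero => simpa only [pow_zero, Module.End.one_eq_id, LinearMap.comp_id] using h
  | succ k ih =>
    refine ⟨fun p q hp hq P => by rw [h.swap p q hp hq], fun t ht htZ => ?_⟩
    simpa only [pow_succ, LinearMap.comp_apply, Module.End.mul_apply] using hT _ ih t ht htZ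

theorem ketPsiWord_regular (c : ℝ) (t : List (Fin N × Bool)) :
    ∀ (Z : Set (Fin N × Bool)) (Λ : Conf N → (List Param →₀ ℂ) →ₗ[ℂ] ℂ),
      IsRegularFunctional Z Λ → t.Nodup → (∀ i ∈ t, i ∉ Z) →
      IsRegular fun P => Λ P (ketPsiWord c (t.map P)) := by
  induction t with
  | nil =>
    intro Z Λ _ _ _
    exact (IsRegular.const 0).congr fun P _ => by simp [ketPsiWord]
  | cons q t ih =>
    intro Z Λ h ht htZ
    have h1 := List.forall_mem_cons.1 htZ
    have h2 := List.nodup_cons.1 ht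
    refine ((ih _ _ (h.comp_cons h1.1) h2.2 (forall_notMem_insert h2.1 h1.2)).sub
      ((IsRegular.const (Complex.I * sqrtC c)).mul (h.ketAWord_regular c ht htZ))).congr
      fun P _ => ?_
    simp only [List.map_cons, ketPsiWord, map_sub, map_smul, LinearMap.comp_apply, smul_eq_mul]

theorem braPsiDagWord_regular (c : ℝ) (t : List (Fin N × Bool)) :
    ∀ (Z : Set (Fin N × Bool)) (Λ : Conf N → (List Param →₀ ℂ) →ₗ[ℂ] ℂ),
      IsRegularFunctional Z Λ → t.Nodup → (∀ i ∈ t, i ∉ Z) →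
      IsRegular fun P => Λ P (braPsiDagWord c (t.map P)) := by
  induction t with
  | nil =>
    intro Z Λ _ _ _
    exact (IsRegular.const 0).congr fun P _ => by simp [braPsiDagWord]
  | cons q t ih =>
    intro Z Λ h ht htZ
    have h1 := List.forall_mem_cons.1 htZ
    have h2 := List.nodup_cons.1 ht
    refine ((ih _ _ (h.comp_cons h1.1) h2.2 (forall_notMem_insert h2.1 h1.2)).add
      ((IsRegular.const (Complex.I * sqrtC c)).mul (h.ketDWord_regular c ht htZ))).congr
      fun P _ => ?_
    simp only [List.map_cons, braPsiDagWord, map_add, map_smul, LinearMap.comp_apply, smul_eq_mul,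
      Aux.braD_eq]

theorem comp_ketPsi_pow (c : ℝ) (h : IsRegularFunctional Z Λ) (k : ℕ) :
    IsRegularFunctional Z fun P => Λ P ∘ₗ (ketPsi c ^ k) :=
  h.comp_pow _ (fun Λ hΛ t ht htZ => by
    simpa only [ketPsi, Finsupp.linearCombination_single, one_smul]
      using ketPsiWord_regular c t Z Λ hΛ ht htZ) k

theorem comp_braPsiDag_pow (c : ℝ) (h : IsRegularFunctional Z Λ) (k : ℕ) :
    IsRegularFunctional Z fun P => Λ P ∘ₗ (braPsiDag c ^ k) :=
  h.comp_pow _ (fun Λ hΛ t ht htZ => by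
    simpa only [braPsiDag, Finsupp.linearCombination_single, one_smul]
      using braPsiDagWord_regular c t Z Λ hΛ ht htZ) k

/-- The dual vacuum reads off the coefficient of the empty word and involves no parameter. Each
further `ℂ` is absorbed by `comp_ketC` and adds its label to `Z`. -/
theorem braWordEval (c : ℝ) (r : List (Fin N × Bool)) (hr : r.Nodup) :
    IsRegularFunctional {i | i ∈ r} fun P => BoseABA.braWordEval c (r.map P) := by
  induction r with
  | nil =>
    refine ⟨fun _ _ _ _ _ => rfl, fun t _ _ => ?_⟩
    cases t with
    | nil => exact (IsRegular.const 1).congr fun P _ => by simp [BoseABA.braWordEval]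
    | cons q t => exact (IsRegular.const 0).congr fun P _ => by simp [BoseABA.braWordEval]
  | cons q r ih =>
    have h := List.nodup_cons.1 hr
    have hs : {i | i ∈ q :: r} = insert q {i | i ∈ r} := by ext; simp
    rw [hs]
    exact (ih h.2).comp_ketC c h.1

/-- The pairing with a fixed ket word, after the action of `Ψ ^ k`. -/
theorem pairing_flip (c : ℝ) (k : ℕ) (t : List (Fin N × Bool)) (ht : t.Nodup) :
    IsRegularFunctional {i | i ∈ t} fun P =>
      (pairing c).flip ((ketPsi c ^ k) (Finsupp.single (t.map P) 1)) := by
  refine ⟨fun p q hp hq P => by rw [map_comp_swap hp hq], fun r hr hrt => ?_⟩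
  -- The same scalar function is read in two ways: with the bra as functional it is known to be
  -- regular on ket words, and this is what the flipped functional needs on bra words.
  simpa only [LinearMap.flip_apply, pairing, Finsupp.linearCombination_single, one_smul,
    LinearMap.comp_apply] using
    ((braWordEval c r hr).comp_ketPsi_pow c k).regular t ht fun i hi hir => hrt i hir hi

end IsRegularFunctional

/-! ### The off-shell matrix element is regular -/

/-- The parameters of an off-shell matrix element. -/
def toConf (xC xB lC lB : Fin N → ℂ) : Conf N :=
  fun i => bif i.2 then (xC i.1, lC i.1) else (xB i.1, lB i.1)

/-- The ket with `Ψ ^ k` applied, in the labels `(j, false)`, is held as a functional; `(Ψ†) ^ k` is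
composed with it, and the result is evaluated on the bra word in the labels `(j, true)`. -/
theorem exists_regular_offShell (c : ℝ) (k N : ℕ) : ∃ F : Conf N → ℂ, IsRegular F ∧
    ∀ xC xB lC lB, F (toConf xC xB lC lB) = offShell c k xC xB lC lB := by
  have hn : ∀ b : Bool, (List.ofFn fun j : Fin N => (j, b)).Nodup := fun b =>
    List.nodup_ofFn.2 fun i j h => (Prod.mk.inj h).1
  refine ⟨_, ((IsRegularFunctional.pairing_flip c k _ (hn false)).comp_braPsiDag_pow c k).regular
    _ (hn true) (by simp [List.mem_ofFn]), fun xC xB lC lB => ?_⟩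
  simp only [LinearMap.comp_apply, LinearMap.flip_apply, offShell, word, List.map_ofFn,
    Function.comp_def, toConf, cond_true, cond_false]

/-! ### Bethe values and vacuum eigenvalue ratios -/

theorem betheL_add (c : ℝ) (x : Fin N → ℂ) (ε : ℂ) :
    betheL c (fun j => x j + ε) = betheL c x := by
  funext j
  simp [betheL]

/-- The hypothesis for `(m, j)` excludes a zero of `S(x_m - x_j)`, and for `(j, m)` a pole. -/
theorem betheL_ne_zero (c : ℝ) (x : Fin N → ℂ)
    (hS : ∀ j m, j ≠ m → x j - x m ≠ Complex.I * c) (j : Fin N) : betheL c x j ≠ 0 := by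
  refine inv_ne_zero (Finset.prod_ne_zero_iff.2 fun m hm => ?_)
  have hm : m ≠ j := Finset.ne_of_mem_erase hm
  refine div_ne_zero (sub_ne_zero.2 (hS m j hm)) fun h => hS j m hm.symm ?_
  linear_combination -h

/-- There are vacuum eigenvalue ratios with prescribed values and vanishing derivatives. -/
theorem exists_isVacuumRatio_zero {x : Fin N → ℂ} (hx : Function.Injective x) (l : Fin N → ℂ) :
    ∃ ell, IsVacuumRatio x l 0 ell := by
  classical
  have hev : ∀ j, ∀ᶠ t in 𝓝 (x j), ∀ m, m ≠ j → dist t (x j) < dist t (x m) := by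
    intro j
    refine eventually_all.2 fun m => ?_
    by_cases hm : m = j
    · simp [hm]
    have h : Tendsto (fun t => dist t (x m) - dist t (x j)) (𝓝 (x j))
        (𝓝 (dist (x j) (x m) - dist (x j) (x j))) := by
      apply Continuous.tendsto; fun_prop
    have h0 : 0 < dist (x j) (x m) - dist (x j) (x j) := by
      simpa using hx.ne (Ne.symm hm)
    filter_upwards [h.eventually (lt_mem_nhds h0)] with t ht _
    linarith
  -- Constant `l j` on the open Voronoi cell of `x j`, and zero off all cells; hence locally
  -- constant near every `x j`.
  let ell : ℂ → ℂ := fun t => ∑ j, if ∀ m, m ≠ j → dist t (x j) < dist t (x m) then l j else 0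
  have hell : ∀ j, ell =ᶠ[𝓝 (x j)] fun _ => l j := by
    intro j
    filter_upwards [hev j] with t ht
    refine (Finset.sum_eq_single j (fun m _ hm => if_neg fun h => ?_) (by simp)).trans (if_pos ht)
    exact lt_asymm (ht m hm) (h j (Ne.symm hm))
  refine ⟨ell, fun j => ⟨?_, (hell j).eq_of_nhds, ?_⟩⟩
  · exact (hell j).differentiableAt_iff.2 (differentiableAt_const _)
  · simp [logDeriv_apply, (hell j).deriv_eq]

/-! ### Limits on the diagonal -/

/-- The off-shell matrix element has the same limit along all paths to the diagonal on which the
difference quotients of the vacuum eigenvalue ratios tend to zero. -/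
theorem exists_offShell_limit (c : ℝ) (k : ℕ) {x : Fin N → ℂ} (hx : Function.Injective x)
    (l : Fin N → ℂ) : ∃ v, ∀ {α : Type} (φ : Filter α) (y lC : α → Fin N → ℂ),
      (∀ᶠ a in φ, ∀ j, y a j ≠ x j) → Tendsto y φ (𝓝 x) → Tendsto lC φ (𝓝 l) →
      (∀ j, Tendsto (fun a => (lC a j - l j) / (y a j - x j)) φ (𝓝 0)) →
      Tendsto (fun a => offShell c k (y a) x (lC a) l) φ (𝓝 v) := by
  obtain ⟨F, hF, hFo⟩ := exists_regular_offShell c k N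
  obtain ⟨v, hv⟩ := hF.exists_tendsto hx l
  refine ⟨v, fun φ y lC hne hy hl hq => ?_⟩
  have h1 : ∀ i : Fin N × Bool,
      Tendsto (fun a => (toConf (y a) x (lC a) l i).1) φ (𝓝 (x i.1)) := by
    rintro ⟨j, _ | _⟩
    · exact tendsto_const_nhds
    · exact tendsto_pi_nhds.1 hy j
  have h2 : ∀ i : Fin N × Bool,
      Tendsto (fun a => (toConf (y a) x (lC a) l i).2) φ (𝓝 (l i.1)) := by
    rintro ⟨j, _ | _⟩
    · exact tendsto_const_nhds
    · exact tendsto_pi_nhds.1 hl j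
  have hd : ∀ᶠ a in φ, (toConf (y a) x (lC a) l).IsDistinct := by
    -- Rapidities from different pairs separate near the diagonal because the `x j` are distinct;
    -- within a pair they differ by the assumption on the path.
    have h3 : ∀ᶠ a in φ, ∀ i i' : Fin N × Bool, i.1 ≠ i'.1 →
        (toConf (y a) x (lC a) l i).1 ≠ (toConf (y a) x (lC a) l i').1 := by
      refine eventually_all.2 fun i => eventually_all.2 fun i' => ?_
      by_cases h : i.1 = i'.1
      · simp [h]
      · filter_upwards [((h1 i).sub (h1 i')).eventually_ne (sub_ne_zero.2 (hx.ne h))] with a ha _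
          using sub_ne_zero.1 ha
    filter_upwards [h3, hne] with a ha hna i i' hii'
    by_cases h : i.1 = i'.1
    · obtain ⟨j, b⟩ := i
      obtain ⟨j', b'⟩ := i'
      obtain rfl : j = j' := h
      cases b <;> cases b'
      · exact absurd rfl hii'
      · exact (hna j).symm
      · exact hna j
      · exact absurd rfl hii'
    · exact ha i i' h
  simpa only [hFo] using hv φ (fun a => toConf (y a) x (lC a) l) hd h1 h2 hq

end BoseABA

theorem mainTheorem5 (c : ℝ) (hc : c ≠ 0) (k N : ℕ) (x : Fin N → ℂ)
    (hx : Function.Injective x) (hS : ∀ j m, j ≠ m → x j - x m ≠ Complex.I * c) :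
    ∃ v : ℂ, BoseABA.HasSymmetricLimit c k x v ∧ BoseABA.HasOnShellMeanValue c k x 0 v := by
  obtain ⟨v, hv⟩ := BoseABA.exists_offShell_limit c k hx (BoseABA.betheL c x)
  refine ⟨v, ?_, BoseABA.exists_isVacuumRatio_zero hx _, fun ell hell => ?_⟩
  · unfold BoseABA.HasSymmetricLimit BoseABA.formFactor
    simp only [BoseABA.betheL_add]
    -- By translation invariance `l^C = l^B` along the whole path, so the difference quotients are
    -- identically zero.
    refine hv _ (fun ε j => x j + ε) (fun _ => BoseABA.betheL c x) ?_ ?_ tendsto_const_nhds ?_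
    · filter_upwards [self_mem_nhdsWithin] with ε hε j
      simpa using hε
    · refine tendsto_nhdsWithin_of_tendsto_nhds ?_
      have h : Continuous fun (ε : ℂ) (j : Fin N) => x j + ε := by fun_prop
      simpa using h.tendsto 0
    · simp
  · have hy : ∀ j, Filter.Tendsto (fun y : Fin N → ℂ => y j)
        (nhdsWithin x {y | ∀ j, y j ≠ x j}) (nhdsWithin (x j) {x j}ᶜ) := fun j =>
      tendsto_nhdsWithin_iff.2 ⟨tendsto_nhdsWithin_of_tendsto_nhds ((continuous_apply j).tendsto x),
        by filter_upwards [self_mem_nhdsWithin] with y hy using hy j⟩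
    refine hv _ (fun y => y) (fun y j => ell (y j)) self_mem_nhdsWithin
      (tendsto_nhdsWithin_of_tendsto_nhds Filter.tendsto_id) (tendsto_pi_nhds.2 fun j => ?_)
      fun j => ?_
    · rw [← (hell j).2.1]
      exact (hell j).1.continuousAt.tendsto.comp ((hy j).mono_right nhdsWithin_le_nhds)
    · obtain ⟨hd, hval, hlog⟩ := hell j
      have hder : deriv ell (x j) = 0 := by
        -- Without a nonzero value the condition `z_j = 0` would say nothing about the derivative:
        -- `logDeriv` is `0` by default where the function vanishes.
        have h0 : ell (x j) ≠ 0 := hval ▸ BoseABA.betheL_ne_zero c x hS j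
        simpa [logDeriv_apply, h0] using hlog
      -- The quotient of the `j`-th pair is the slope of `ell` at `x j`, so it tends to the
      -- derivative.
      have h := (hasDerivAt_iff_tendsto_slope.1 hd.hasDerivAt).comp (hy j)
      rw [hder] at h
      refine h.congr fun y => ?_
      rw [Function.comp_apply, slope_def_field, hval]
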